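/- Let $\mathscr{S}(\mathbb{R})$ be the space of complex-valued rapidly decreasing smooth functions on $\mathbb{R}$ with its usual Fréchet topology, and let $\mathcal{L}_b(\mathscr{S}(\mathbb{R}))$ be the space of continuous linear operators on it with the topology of uniform convergence on bounded sets. For $\varphi:\mathbb{R}\to\mathbb{R}$ and $\psi:\mathbb{R}\to\mathbb{C}$ smooth put $C_{\psi,\varphi}f=\psi\cdot(f\circ\varphi)$ and $C_\varphi=C_{1,\varphi}$; we say that $C_{\psi,\varphi}$ acts on $\mathscr{S}(\mathbb{R})$ if $C_{\psi,\varphi}f\in\mathscr{S}(\mathbb{R})$ for every $f\in\mathscr{S}(\mathbb{R})$. Let $\mathscr{O}_M(\mathbb{R})$ be the space of smooth functions $\psi:\mathbb{R}\to\mathbb{C}$ all of whose derivatives are polynomially bounded. A smooth $\psi:\mathbb{R}\to\mathbb{C}$ is of small decay with respect to $\varphi$ if there is $m>0$ with $\inf_{|x|\ge m}(1+|x|)^m(1+|\varphi(x)|)^m|\psi(x)|>0$. For a continuous linear operator $T$ on $\mathscr{S}(\mathbb{R})$ let $T_{[n]}=\frac1n\sum_{m=1}^nT^m$, $n\ge 1$.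 Then $T$ is called power bounded if $\{T^n: n\in\mathbb{N}\}$ is equicontinuous, mean ergodic if $(T_{[n]}f)_n$ converges in $\mathscr{S}(\mathbb{R})$ for every $f$, uniformly mean ergodic if $(T_{[n]})_n$ converges in $\mathcal{L}_b(\mathscr{S}(\mathbb{R}))$, and Cesàro bounded if $\{T_{[n]}: n\ge1\}$ is bounded in $\mathcal{L}_b(\mathscr{S}(\mathbb{R}))$. A statement that $C_{\psi,\varphi}$ has one of these properties, or that its iterates converge in $\mathcal{L}_b(\mathscr{S}(\mathbb{R}))$, includes that $C_{\psi,\varphi}$ is a well-defined continuous linear operator on $\mathscr{S}(\mathbb{R})$. **Theorem.** Let $\varphi:\mathbb{R}\to\mathbb{R}$ be a polynomial of degree $\ge 2$. If $\varphi$ has no (real) fixed points, then $\deg\varphi$ is even. Moreover, the following are equivalent: 1. $\varphi$ has no fixed points; 2. $C_\varphi$ is power bounded on $\mathscr{S}(\mathbb{R})$; 3. $C_\varphi$ is mean ergodic on $\mathscr{S}(\mathbb{R})$; 4. $C_\varphi$ is uniformly mean ergodic on $\mathscr{S}(\mathbb{R})$; 5. $C_\varphi^n\to0$ in $\mathcal{L}_b(\mathscr{S}(\mathbb{R}))$;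 6. $C_\varphi$ is Cesàro bounded on $\mathscr{S}(\mathbb{R})$; 7. $C_{\psi,\varphi}$ is power bounded on $\mathscr{S}(\mathbb{R})$ for every $\psi\in\mathscr{O}_M(\mathbb{R})$; 8. $C_{\psi,\varphi}$ is power bounded on $\mathscr{S}(\mathbb{R})$ for every smooth $\psi$ of small decay with respect to $\varphi$ for which $C_{\psi,\varphi}$ acts on $\mathscr{S}(\mathbb{R})$; 9. $C_{\psi,\varphi}^n\to0$ in $\mathcal{L}_b(\mathscr{S}(\mathbb{R}))$ for every $\psi\in\mathscr{O}_M(\mathbb{R})$; 10. $C_{\psi,\varphi}^n\to0$ in $\mathcal{L}_b(\mathscr{S}(\mathbb{R}))$ for every $\psi$ as in 8; 11. $C_{\psi,\varphi}$ is mean ergodic on $\mathscr{S}(\mathbb{R})$ for every $\psi\in\mathscr{O}_M(\mathbb{R})$; 12. $C_{\psi,\varphi}$ is mean ergodic on $\mathscr{S}(\mathbb{R})$ for every $\psi$ as in 8; 13. $C_{\psi,\varphi}$ is uniformly mean ergodic on $\mathscr{S}(\mathbb{R})$ for every $\psi\in\mathscr{O}_M(\mathbb{R})$; 14. $C_{\psi,\varphi}$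 is uniformly mean ergodic on $\mathscr{S}(\mathbb{R})$ for every $\psi$ as in 8. -/

import Mathlib

open Filter Topology
open scoped ContDiff SchwartzMap

noncomputable section

section LocallyConvex

variable {E : Type*} [AddCommGroup E] [Module ℂ E] [UniformSpace E] [IsUniformAddGroup E]
  [ContinuousConstSMul ℂ E]

/-- `T` is power bounded: the set of its iterates is equicontinuous. -/
def PowerBounded (T : E →L[ℂ] E) : Prop :=
  Equicontinuous (fun (n : ℕ) (x : E) => (T ^ n) x)

/-- The Cesàro mean `(1/n) ∑_{m=1}^n T^m` (with the harmless value `0` at `n = 0`). -/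
def cesaroMean (T : E →L[ℂ] E) (n : ℕ) : E →L[ℂ] E :=
  (n : ℂ)⁻¹ • ∑ m ∈ Finset.Icc 1 n, T ^ m

/-- `T` is mean ergodic: the Cesàro means of `T` converge pointwise. -/
def MeanErgodic (T : E →L[ℂ] E) : Prop :=
  ∀ x : E, ∃ y : E, Tendsto (fun n : ℕ => cesaroMean T n x) atTop (𝓝 y)

/-- `T` is uniformly mean ergodic: the Cesàro means of `T` converge in `L_b(E)`, that is, for the
topology of uniform convergence on bounded sets, which is the topology that Mathlib puts on
`E →L[ℂ] E`. -/
def UniformlyMeanErgodic (T : E →L[ℂ] E) : Prop :=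
  ∃ P : E →L[ℂ] E, Tendsto (fun n : ℕ => cesaroMean T n) atTop (𝓝 P)

/-- The iterates of `T` converge to `0` in `L_b(E)`. -/
def IteratesTendToZero (T : E →L[ℂ] E) : Prop :=
  Tendsto (fun n : ℕ => T ^ n) atTop (𝓝 (0 : E →L[ℂ] E))

/-- `T` is Cesàro bounded: the sequence of its Cesàro means is bounded in `L_b(E)`. -/
def CesaroBounded (T : E →L[ℂ] E) : Prop :=
  Bornology.IsVonNBounded ℂ (Set.range fun n : ℕ => cesaroMean T n)

end LocallyConvex

/-- The weighted composition `f ↦ ψ · (f ∘ φ)` acts on the Schwartz space: it maps every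
Schwartz function to a Schwartz function. -/
def ActsOnSchwartz (ψ : ℝ → ℂ) (φ : ℝ → ℝ) : Prop :=
  ∀ f : 𝓢(ℝ, ℂ), ∃ g : 𝓢(ℝ, ℂ), ∀ x : ℝ, g x = ψ x * f (φ x)

/-- The weighted composition operator `C_{ψ,φ} f = ψ · (f ∘ φ)` is a well-defined continuous
linear operator on the Schwartz space (it is then unique) and has the property `P`. -/
def WeightedCompositionHas (P : (𝓢(ℝ, ℂ) →L[ℂ] 𝓢(ℝ, ℂ)) → Prop) (ψ : ℝ → ℂ) (φ : ℝ → ℝ) : Prop :=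
  ∃ T : 𝓢(ℝ, ℂ) →L[ℂ] 𝓢(ℝ, ℂ), (∀ (f : 𝓢(ℝ, ℂ)) (x : ℝ), T f x = ψ x * f (φ x)) ∧ P T

/-- The composition operator `C_φ f = f ∘ φ` is a continuous linear operator on the Schwartz
space and has the property `P`. -/
def CompositionHas (P : (𝓢(ℝ, ℂ) →L[ℂ] 𝓢(ℝ, ℂ)) → Prop) (φ : ℝ → ℝ) : Prop :=
  WeightedCompositionHas P (fun _ => 1) φ

/-- `ψ` is of small decay with respect to `φ`: for some real `m > 0` the infimum over `|x| ≥ m` of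
`(1+|x|)^m (1+|φ(x)|)^m |ψ(x)|` is positive. -/
def SmallDecay (ψ : ℝ → ℂ) (φ : ℝ → ℝ) : Prop :=
  ∃ m : ℝ, 0 < m ∧ ∃ c : ℝ, 0 < c ∧
    ∀ x : ℝ, m ≤ |x| → c ≤ (1 + |x|) ^ m * (1 + |φ x|) ^ m * ‖ψ x‖

/-- `C_{ψ,φ}` has the property `P` for every `ψ` in the space `O_M(ℝ)` of smooth functions all of
whose derivatives are polynomially bounded. -/
def ForAllMultipliers (P : (𝓢(ℝ, ℂ) →L[ℂ] 𝓢(ℝ, ℂ)) → Prop) (φ : ℝ → ℝ) : Prop :=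
  ∀ ψ : ℝ → ℂ, ψ.HasTemperateGrowth → WeightedCompositionHas P ψ φ

/-- `C_{ψ,φ}` has the property `P` for every smooth `ψ` of small decay with respect to `φ` for
which `C_{ψ,φ}` acts on the Schwartz space. -/
def ForAllSmallDecay (P : (𝓢(ℝ, ℂ) →L[ℂ] 𝓢(ℝ, ℂ)) → Prop) (φ : ℝ → ℝ) : Prop :=
  ∀ ψ : ℝ → ℂ, ContDiff ℝ ∞ ψ → SmallDecay ψ φ → ActsOnSchwartz ψ φ →
    WeightedCompositionHas P ψ φ

end

/-!
Write `T` for the operator `C_{ψ,φ}`. The fourteen statements are compared through two extreme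
properties of an operator: geometric decay (`HasGeometricDecay`), which implies power boundedness,
convergence of the iterates to `0`, (uniform) mean ergodicity and Cesàro boundedness, and pointwise
boundedness of the Cesàro means (`CesaroPointwiseBounded`), which each of these implies.

*No fixed points imply geometric decay.* A derivative of `T f` at `x` is at most
`C (1 + |x|) ^ p` times the derivatives of `f` at `φ x`. Since `1 + |φ x| ≥ c (1 + |x|) ^ 2`, in the
weighted norms `sup (1 + |x|) ^ L |f⁽ᵇ⁾(x)|`, `b ≤ J`, with `L` large, one application of `T` gains a
factor `K / (1 + |x|)` (`exists_weightedBound_step`). Hence `T` contracts the norm over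
`{x | R ≤ |x|}` for large `R`. If `φ` has no fixed points, compactness of `[-R, R]` shows that some
iterate of `φ` maps the whole line into `{x | R ≤ |x|}` (`exists_iterate_mem_of_forall_ne`), so the
contraction controls all Schwartz seminorms (`hasGeometricDecay_of_forall_ne`). This uses only that
`ψ` belongs to `O_M`; a gliding hump argument shows that this is automatic for a smooth `ψ` for
which `C_{ψ,φ}` acts on the Schwartz space (`ActsOnSchwartz.hasTemperateGrowth`).

*Fixed points make the Cesàro means of `C_φ` unbounded.* If `φ` has a fixed point, then `φ ∘ φ` has
an extremal fixed point `a` that repels on its outer side, and backward orbits `z n` of outer points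
`y` approach `a`. The identity and `φ ∘ φ` have finite order of contact at `a`, so
`|z n - a| ≤ C n ^ (-1 / p)` (`Polynomial.exists_hasBackwardOrbit_comp_self`). For a nonnegative bump
`f` at `y` that vanishes near the cycle of `a`, the Cesàro mean of order `2 n` vanishes near `a` but is
at least `1 / (2 n)` at `z n`. If its derivative of order `2 p` were bounded by `B` for all `n`, Taylor's
estimate (`norm_le_of_eventuallyEq_zero`) would give `1 / (2 n) ≤ B |z n - a| ^ (2 p) ≤ B' / n ^ 2`,
which is false for large `n` (`not_cesaroPointwiseBounded_of_hasBackwardOrbit`).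
-/

/-! ### Derivatives of weighted compositions -/

theorem Function.HasTemperateGrowth.norm_iteratedDeriv_le {F : Type*} [NormedAddCommGroup F]
    [NormedSpace ℝ F] {f : ℝ → F} (hf : f.HasTemperateGrowth) (n : ℕ) :
    ∃ (p : ℕ) (C : ℝ), 0 ≤ C ∧ ∀ x : ℝ, ‖iteratedDeriv n f x‖ ≤ C * (1 + |x|) ^ p := by
  obtain ⟨p, C, hC, h⟩ := hf.norm_iteratedFDeriv_le_uniform n
  refine ⟨p, C, hC, fun x => ?_⟩
  rw [← norm_iteratedFDeriv_eq_norm_iteratedDeriv]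
  exact h n le_rfl x

theorem hasTemperateGrowth_of_iteratedDeriv {F : Type*} [NormedAddCommGroup F]
    [NormedSpace ℝ F] {f : ℝ → F} (hf : ContDiff ℝ ∞ f)
    (h : ∀ n : ℕ, ∃ (p : ℕ) (C : ℝ), ∀ x : ℝ, ‖iteratedDeriv n f x‖ ≤ C * (1 + |x|) ^ p) :
    f.HasTemperateGrowth := by
  refine ⟨hf, fun n => ?_⟩
  obtain ⟨p, C, h⟩ := h n
  refine ⟨p, C, fun x => ?_⟩
  rw [norm_iteratedFDeriv_eq_norm_iteratedDeriv]
  exact h x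

theorem Function.HasTemperateGrowth.deriv {F : Type*} [NormedAddCommGroup F]
    [NormedSpace ℝ F] {f : ℝ → F} (hf : f.HasTemperateGrowth) :
    (_root_.deriv f).HasTemperateGrowth := by
  refine hasTemperateGrowth_of_iteratedDeriv (contDiff_infty_iff_deriv.1 hf.1).2 fun n => ?_
  obtain ⟨p, C, -, h⟩ := hf.norm_iteratedDeriv_le (n + 1)
  refine ⟨p, C, fun x => ?_⟩
  rw [← iteratedDeriv_succ']
  exact h x

/-- The `j`-th derivative of `ψ · (f ∘ φ)` at `x` involves only the derivatives of `f` at `φ x` of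
order at most `j`, with coefficients of polynomial growth that do not depend on `f`. The induction
on `j` runs over all `ψ`, since `(ψ · (f ∘ φ))' = ψ' · (f ∘ φ) + ψ φ' · (f' ∘ φ)`. -/
theorem exists_iteratedDeriv_weightedComp_le {φ : ℝ → ℝ} (hφ : φ.HasTemperateGrowth) (j : ℕ) :
    ∀ {ψ : ℝ → ℂ}, ψ.HasTemperateGrowth → ∃ (p : ℕ) (C : ℝ), 0 ≤ C ∧
      ∀ f : ℝ → ℂ, ContDiff ℝ ∞ f → ∀ x M : ℝ, (∀ b ≤ j, ‖iteratedDeriv b f (φ x)‖ ≤ M) →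
        ‖iteratedDeriv j (fun y => ψ y * f (φ y)) x‖ ≤ C * (1 + |x|) ^ p * M := by
  induction j with
  | zero =>
    intro ψ hψ
    obtain ⟨p, C, hC, h⟩ := hψ.norm_iteratedDeriv_le 0
    refine ⟨p, C, hC, fun f _ x M hM => ?_⟩
    have h1 := h x
    have h2 := hM 0 le_rfl
    simp only [iteratedDeriv_zero, norm_mul] at h1 h2 ⊢
    gcongr
  | succ j ih =>
    intro ψ hψ
    obtain ⟨p₁, C₁, hC₁, h₁⟩ := ih hψ.deriv
    have hψ₂ : (fun y => ψ y * ((deriv φ y : ℝ) : ℂ)).HasTemperateGrowth :=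
      hψ.mul (Function.Complex.hasTemperateGrowth_ofReal.comp hφ.deriv)
    obtain ⟨p₂, C₂, hC₂, h₂⟩ := ih hψ₂
    refine ⟨p₁ + p₂, C₁ + C₂, by positivity, fun f hf x M hM => ?_⟩
    have hM0 : 0 ≤ M := (norm_nonneg _).trans (hM 0 (Nat.zero_le _))
    have hf' : ContDiff ℝ ∞ (deriv f) := (contDiff_infty_iff_deriv.1 hf).2
    have hder : deriv (fun y => ψ y * f (φ y)) = fun y =>
        deriv ψ y * f (φ y) + (ψ y * ((deriv φ y : ℝ) : ℂ)) * deriv f (φ y) := by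
      funext y
      have d1 : HasDerivAt ψ (deriv ψ y) y := ((hψ.1.differentiable (by simp)) y).hasDerivAt
      have d2 : HasDerivAt φ (deriv φ y) y := ((hφ.1.differentiable (by simp)) y).hasDerivAt
      have d3 : HasDerivAt f (deriv f (φ y)) (φ y) :=
        ((hf.differentiable (by simp)) (φ y)).hasDerivAt
      have := (d1.mul (d3.scomp y d2)).deriv
      simp only [Function.comp_def, Complex.real_smul] at this
      refine Eq.trans this ?_
      ring
    rw [iteratedDeriv_succ', hder, iteratedDeriv_fun_add]
    rotate_left
    · exact ((hψ.deriv.1.mul (hf.comp hφ.1)).of_le (mod_cast le_top)).contDiffAt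
    · exact ((hψ₂.1.mul (hf'.comp hφ.1)).of_le (mod_cast le_top)).contDiffAt
    have e1 := h₁ f hf x M fun b hb => hM b (by omega)
    have e2 := h₂ (deriv f) hf' x M fun b hb => by
      rw [← iteratedDeriv_succ']; exact hM (b + 1) (by omega)
    have hx : 1 ≤ 1 + |x| := by linarith [abs_nonneg x]
    have g1 : (1 + |x|) ^ p₁ ≤ (1 + |x|) ^ (p₁ + p₂) := pow_le_pow_right₀ hx (by omega)
    have g2 : (1 + |x|) ^ p₂ ≤ (1 + |x|) ^ (p₁ + p₂) := pow_le_pow_right₀ hx (by omega)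
    calc _ ≤ C₁ * (1 + |x|) ^ p₁ * M + C₂ * (1 + |x|) ^ p₂ * M := norm_add_le_of_le e1 e2
      _ ≤ C₁ * (1 + |x|) ^ (p₁ + p₂) * M + C₂ * (1 + |x|) ^ (p₁ + p₂) * M := by gcongr
      _ = _ := by ring

theorem exists_iteratedDeriv_weightedComp_le_uniform {φ : ℝ → ℝ} (hφ : φ.HasTemperateGrowth)
    {ψ : ℝ → ℂ} (hψ : ψ.HasTemperateGrowth) (J : ℕ) : ∃ (p : ℕ) (C : ℝ), 0 ≤ C ∧
      ∀ f : ℝ → ℂ, ContDiff ℝ ∞ f → ∀ x M : ℝ, (∀ b ≤ J, ‖iteratedDeriv b f (φ x)‖ ≤ M) →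
        ∀ j ≤ J, ‖iteratedDeriv j (fun y => ψ y * f (φ y)) x‖ ≤ C * (1 + |x|) ^ p * M := by
  choose p C hC h using fun j => exists_iteratedDeriv_weightedComp_le hφ j hψ
  refine ⟨∑ j ∈ Finset.range (J + 1), p j, ∑ j ∈ Finset.range (J + 1), C j,
    Finset.sum_nonneg fun j _ => hC j, fun f hf x M hM j hj => ?_⟩
  have hM0 : 0 ≤ M := (norm_nonneg _).trans (hM 0 (Nat.zero_le _))
  have hx : 1 ≤ 1 + |x| := by linarith [abs_nonneg x]
  have hj' : j ∈ Finset.range (J + 1) := Finset.mem_range.2 (by omega)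
  refine (h j f hf x M fun b hb => hM b (hb.trans hj)).trans ?_
  have h1 : C j ≤ ∑ j ∈ Finset.range (J + 1), C j :=
    Finset.single_le_sum (fun i _ => hC i) hj'
  have h2 : p j ≤ ∑ j ∈ Finset.range (J + 1), p j :=
    Finset.single_le_sum (fun i _ => Nat.zero_le _) hj'
  gcongr
  exact (hC j).trans h1

/-! ### Geometric decay of the iterates -/

/-- Every Schwartz seminorm of `T ^ n f` is at most `2⁻ⁿ` times a continuous seminorm of `f`. -/
def HasGeometricDecay (T : 𝓢(ℝ, ℂ) →L[ℂ] 𝓢(ℝ, ℂ)) : Prop :=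
  ∀ k j : ℕ, ∃ q : Seminorm ℂ 𝓢(ℝ, ℂ), Continuous q ∧
    ∀ (n : ℕ) (f : 𝓢(ℝ, ℂ)), SchwartzMap.seminorm ℂ k j ((T ^ n) f) ≤ (1 / 2) ^ n * q f

/-- `M` bounds the derivatives of `f` of order at most `J` on `S`, with weight `(1 + |x|) ^ L`. -/
def WeightedBoundOn (L J : ℕ) (S : Set ℝ) (f : ℝ → ℂ) (M : ℝ) : Prop :=
  ∀ x ∈ S, ∀ b ≤ J, (1 + |x|) ^ L * ‖iteratedDeriv b f x‖ ≤ M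

/-- One application of a weighted composition operator gains a factor `1 + |x|`, for a weight of
large exponent: the weight at `φ x` is at least the square of the weight at `x`, up to a constant,
and this beats the polynomial growth of `ψ`, `φ` and their derivatives. -/
theorem exists_weightedBound_step {φ : ℝ → ℝ} (hφ : φ.HasTemperateGrowth) {ψ : ℝ → ℂ}
    (hψ : ψ.HasTemperateGrowth) {c : ℝ} (hc : 0 < c) (hcφ : ∀ x, c * (1 + |x|) ^ 2 ≤ 1 + |φ x|)
    (k J : ℕ) : ∃ L : ℕ, k ≤ L ∧ ∃ K : ℝ, 1 ≤ K ∧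
      ∀ (f : ℝ → ℂ), ContDiff ℝ ∞ f → ∀ (x M : ℝ), WeightedBoundOn L J {φ x} f M →
        ∀ b ≤ J, (1 + |x|) ^ L * ‖iteratedDeriv b (fun y => ψ y * f (φ y)) x‖
          ≤ K / (1 + |x|) * M := by
  obtain ⟨p, C, hC, h⟩ := exists_iteratedDeriv_weightedComp_le_uniform hφ hψ J
  set L := k + p + 1 with hL
  refine ⟨L, by omega, max 1 (C / c ^ L), le_max_left _ _, fun f hf x M hM b hb => ?_⟩
  have hx : 1 ≤ 1 + |x| := by linarith [abs_nonneg x]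
  have hx0 : 0 < 1 + |x| := by linarith
  have hy0 : 0 < 1 + |φ x| := by linarith [abs_nonneg (φ x)]
  have hM0 : 0 ≤ M := le_trans (by positivity) (hM (φ x) rfl 0 (Nat.zero_le _))
  have key := h f hf x (M / (1 + |φ x|) ^ L) (fun b hb => by
    rw [le_div_iff₀ (by positivity), mul_comm]
    exact hM (φ x) rfl b hb) b hb
  have hw : c ^ L * (1 + |x|) ^ (L + p + 1) ≤ (1 + |φ x|) ^ L :=
    calc c ^ L * (1 + |x|) ^ (L + p + 1) ≤ c ^ L * (1 + |x|) ^ (2 * L) := by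
          gcongr
          · omega
      _ = (c * (1 + |x|) ^ 2) ^ L := by rw [mul_pow, ← pow_mul]
      _ ≤ _ := pow_le_pow_left₀ (by positivity) (hcφ x) L
  calc _ ≤ (1 + |x|) ^ L * (C * (1 + |x|) ^ p * (M / (1 + |φ x|) ^ L)) := by gcongr
    _ ≤ (1 + |x|) ^ L * (C * (1 + |x|) ^ p * (M / (c ^ L * (1 + |x|) ^ (L + p + 1)))) := by gcongr
    _ = (C / c ^ L) / (1 + |x|) * M := by
      field_simp
      ring
    _ ≤ _ := by
      gcongr
      exact le_max_right _ _

/-- If `φ` has no fixed points and `{x | R ≤ |x|}` is forward invariant, a single iterate of `φ` maps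
the whole line into this set. -/
theorem exists_iterate_mem_of_forall_ne {φ : ℝ → ℝ} (hφ : Continuous φ) (hfix : ∀ x, φ x ≠ x)
    {R : ℝ} (hR : 0 ≤ R) (hRφ : ∀ x, R ≤ |x| → R ≤ |φ x|) : ∃ N : ℕ, ∀ x, R ≤ |φ^[N] x| := by
  -- by compactness a point of `[-R, R]` is moved by at least `δ`, always in the same direction
  obtain ⟨s, hs, δ, hδ, hstep⟩ : ∃ s : ℝ, |s| = 1 ∧ ∃ δ > 0, ∀ x, |x| ≤ R → δ ≤ s * (φ x - x) := by
    have hsign : (∀ x, 0 < φ x - x) ∨ (∀ x, φ x - x < 0) := by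
      by_contra! h
      obtain ⟨⟨a, ha⟩, ⟨b, hb⟩⟩ := h
      obtain ⟨z, hz⟩ := mem_range_of_exists_le_of_exists_ge (c := (0 : ℝ))
        (hφ.sub continuous_id) ⟨a, ha⟩ ⟨b, hb⟩
      exact hfix z (sub_eq_zero.1 hz)
    obtain ⟨s, hs, hpos⟩ : ∃ s : ℝ, |s| = 1 ∧ ∀ x, 0 < s * (φ x - x) := by
      rcases hsign with h | h
      · exact ⟨1, by simp, fun x => by linarith [h x]⟩
      · exact ⟨-1, by simp, fun x => by linarith [h x]⟩
    obtain ⟨z, -, hz⟩ := (isCompact_Icc (a := -R) (b := R)).exists_isMinOn ⟨0, by simp [hR]⟩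
      (f := fun x => s * (φ x - x)) (by fun_prop)
    exact ⟨s, hs, _, hpos z, fun x hx => hz (abs_le.1 hx)⟩
  obtain ⟨N, hN⟩ := exists_nat_gt (2 * R / δ)
  rw [div_lt_iff₀ hδ] at hN
  refine ⟨N, fun x => ?_⟩
  by_contra! hlt
  have hsmall : ∀ n ≤ N, |φ^[n] x| < R := by
    intro n hn
    by_contra! hge
    have : ∀ m, R ≤ |φ^[m + n] x| := by
      intro m
      induction m with
      | zero => simpa using hge
      | succ m ih =>
        rw [show m + 1 + n = (m + n) + 1 by ring, Function.iterate_succ_apply']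
        exact hRφ _ ih
    have h2 := this (N - n)
    rw [Nat.sub_add_cancel hn] at h2
    linarith
  have hsum : ∀ n ≤ N, n * δ ≤ s * (φ^[n] x - x) := by
    intro n
    induction n with
    | zero => simp
    | succ n ih =>
      intro hn
      have h1 := ih (by omega)
      have h2 := hstep _ (hsmall n (by omega)).le
      rw [Function.iterate_succ_apply']
      push_cast
      linarith
  have h1 := hsum N le_rfl
  have h2 : s * (φ^[N] x - x) ≤ |φ^[N] x - x| := by
    calc _ ≤ |s * (φ^[N] x - x)| := le_abs_self _
      _ = _ := by rw [abs_mul, hs, one_mul]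
  have h3 := abs_sub (φ^[N] x) x
  have h4 := hsmall 0 (Nat.zero_le _)
  simp only [Function.iterate_zero, id] at h4
  linarith

theorem continuous_finset_sup_schwartzSeminormFamily (s : Finset (ℕ × ℕ)) :
    Continuous (s.sup (schwartzSeminormFamily ℂ ℝ ℂ) : Seminorm ℂ 𝓢(ℝ, ℂ)) := by
  induction s using Finset.cons_induction with
  | empty => exact continuous_const
  | cons i s hi ih =>
    rw [Finset.sup_cons, Seminorm.coe_sup]
    exact ((schwartz_withSeminorms ℂ ℝ ℂ).continuous_seminorm i).max ih

theorem WeightedBoundOn.le_of_seminorm {L J : ℕ} {S : Set ℝ} (f : 𝓢(ℝ, ℂ)) :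
    WeightedBoundOn L J S f
      (((2 : ℝ) ^ L) * (Finset.Iic (L, J)).sup (schwartzSeminormFamily ℂ ℝ ℂ) f) := by
  intro x _ b hb
  rw [← norm_iteratedFDeriv_eq_norm_iteratedDeriv]
  exact SchwartzMap.one_add_le_sup_seminorm_apply (m := (L, J)) le_rfl hb f x

/-- If `φ` grows at least quadratically and has no fixed points, the iterates of `C_{ψ,φ}` decay
geometrically: the operator is a contraction for a weighted norm over `{x | R ≤ |x|}`, and a fixed
iterate of `φ` maps the line into that set. -/
theorem hasGeometricDecay_of_forall_ne {φ : ℝ → ℝ} (hφ : φ.HasTemperateGrowth) {ψ : ℝ → ℂ}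
    (hψ : ψ.HasTemperateGrowth) {c : ℝ} (hc : 0 < c) (hcφ : ∀ x, c * (1 + |x|) ^ 2 ≤ 1 + |φ x|)
    (hfix : ∀ x, φ x ≠ x) {T : 𝓢(ℝ, ℂ) →L[ℂ] 𝓢(ℝ, ℂ)}
    (hT : ∀ (f : 𝓢(ℝ, ℂ)) (x : ℝ), T f x = ψ x * f (φ x)) : HasGeometricDecay T := by
  intro k J
  obtain ⟨L, hkL, K, hK, hstep⟩ := exists_weightedBound_step hφ hψ hc hcφ k J
  have hTf : ∀ f : 𝓢(ℝ, ℂ), (T f : ℝ → ℂ) = fun y => ψ y * f (φ y) := fun f => funext (hT f)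
  -- `R` makes the one-step factor at most `1 / 2` and `{x | R ≤ |x|}` forward invariant
  obtain ⟨R, hR0, hRK, hRc⟩ : ∃ R : ℝ, 0 ≤ R ∧ 2 * K ≤ 1 + R ∧ 1 ≤ c * (1 + R) :=
    ⟨2 * K + 1 / c, by positivity, by linarith [one_div_pos.2 hc], by
      have : c * (1 + (2 * K + 1 / c)) = c + 2 * K * c + 1 := by field_simp; ring
      rw [this]
      have : 0 ≤ 2 * K * c := by positivity
      linarith⟩
  have hinv : ∀ x, R ≤ |x| → R ≤ |φ x| := by
    intro x hx
    have h1 : 1 ≤ c * (1 + |x|) := hRc.trans (by gcongr)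
    have h2 := hcφ x
    have h3 : 1 + |x| ≤ c * (1 + |x|) ^ 2 := by nlinarith [abs_nonneg x]
    linarith
  obtain ⟨N, hN⟩ := exists_iterate_mem_of_forall_ne hφ.1.continuous hfix hR0 hinv
  have hM0 : ∀ {S : Set ℝ} {f : ℝ → ℂ} {M x : ℝ}, x ∈ S → WeightedBoundOn L J S f M → 0 ≤ M :=
    fun hx h => le_trans (by positivity) (h _ hx 0 (Nat.zero_le _))
  -- one step, on the preimage of the set where `f` is controlled
  have hone : ∀ (f : 𝓢(ℝ, ℂ)) (S : Set ℝ) (M : ℝ), WeightedBoundOn L J S f M →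
      WeightedBoundOn L J (φ ⁻¹' S) (T f) (K * M) := by
    intro f S M h x hx b hb
    rw [hTf]
    refine (hstep f (f.smooth ⊤) x M (fun y hy => h y (by rw [hy]; exact hx)) b hb).trans ?_
    have : 0 ≤ M := hM0 (x := φ x) hx h
    gcongr
    exact div_le_self (by linarith) (by linarith [abs_nonneg x])
  have hfar : ∀ (n : ℕ) (f : 𝓢(ℝ, ℂ)) (M : ℝ), WeightedBoundOn L J {x | R ≤ |x|} f M →
      WeightedBoundOn L J {x | R ≤ |x|} ((T ^ n) f) ((1 / 2) ^ n * M) := by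
    intro n f M h
    induction n with
    | zero => simpa using h
    | succ n ih =>
      intro x hx b hb
      have hx' : R ≤ |x| := hx
      rw [pow_succ', mul_apply_eq_comp, hTf]
      refine (hstep _ (SchwartzMap.smooth _ ⊤) x _
        (fun y hy => ih y (by rw [hy]; exact hinv x hx)) b hb).trans ?_
      have h0 := hM0 hx ih
      rw [pow_succ', mul_assoc]
      refine mul_le_mul_of_nonneg_right ?_ h0
      rw [div_le_div_iff₀ (by positivity) (by norm_num)]
      linarith
  have hiter : ∀ (i : ℕ) (f : 𝓢(ℝ, ℂ)) (S : Set ℝ) (M : ℝ), WeightedBoundOn L J S f M →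
      WeightedBoundOn L J (φ^[i] ⁻¹' S) ((T ^ i) f) (K ^ i * M) := by
    intro i f S M h
    induction i with
    | zero => simpa using h
    | succ i ih =>
      rw [pow_succ', mul_apply_eq_comp, pow_succ', mul_assoc, Function.iterate_succ,
        Set.preimage_comp]
      exact hone _ _ _ ih
  -- the first `N` steps bring every point into `{x | R ≤ |x|}`, at the cost of a constant
  have hall : ∀ (n : ℕ) (f : 𝓢(ℝ, ℂ)) (M : ℝ), WeightedBoundOn L J Set.univ f M →
      WeightedBoundOn L J Set.univ ((T ^ n) f) ((1 / 2) ^ n * ((2 * K) ^ N * M)) := by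
    intro n f M h
    have hM := hM0 (Set.mem_univ 0) h
    rcases le_total N n with hn | hn
    · obtain ⟨m, rfl⟩ := Nat.exists_eq_add_of_le hn
      have h1 := hiter N _ _ _ (hfar m f M fun x _ => h x (Set.mem_univ x))
      rw [← mul_apply_eq_comp, ← pow_add] at h1
      intro x _ b hb
      refine (h1 x (hN x) b hb).trans (le_of_eq ?_)
      have h3 : ((1 : ℝ) / 2) ^ N * 2 ^ N = 1 := by rw [← mul_pow]; norm_num
      rw [mul_pow, pow_add]
      linear_combination (-K ^ N * (1 / 2) ^ m * M) * h3
    · intro x _ b hb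
      refine (hiter n f _ M h x (Set.mem_univ _) b hb).trans ?_
      have h2 : (2 * K) ^ n ≤ (2 * K) ^ N := pow_le_pow_right₀ (by linarith) hn
      have h3 : ((1 : ℝ) / 2) ^ n * 2 ^ n = 1 := by rw [← mul_pow]; norm_num
      calc K ^ n * M = (1 / 2) ^ n * ((2 * K) ^ n * M) := by
            rw [mul_pow]
            linear_combination (-K ^ n * M) * h3
        _ ≤ _ := by gcongr
  let q₀ : Seminorm ℂ 𝓢(ℝ, ℂ) := (Finset.Iic (L, J)).sup (schwartzSeminormFamily ℂ ℝ ℂ)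
  let D : NNReal := Real.toNNReal ((2 * K) ^ N * 2 ^ L)
  have hD : (D : ℝ) = (2 * K) ^ N * 2 ^ L := Real.coe_toNNReal _ (by positivity)
  refine ⟨D • q₀, ?_, fun n f => ?_⟩
  · exact (continuous_finset_sup_schwartzSeminormFamily _).const_smul D
  · have hDq : (D • q₀) f = (2 * K) ^ N * (2 ^ L * q₀ f) := by
      rw [smul_apply, NNReal.smul_def, hD, smul_eq_mul, mul_assoc]
    rw [hDq]
    refine SchwartzMap.seminorm_le_bound' ℂ k J _ (by positivity) fun x => ?_
    refine le_trans ?_ (hall n f _ (WeightedBoundOn.le_of_seminorm f) x (Set.mem_univ x) J le_rfl)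
    gcongr
    calc |x| ^ k ≤ (1 + |x|) ^ k := by gcongr; linarith
      _ ≤ (1 + |x|) ^ L := pow_le_pow_right₀ (by linarith [abs_nonneg x]) hkL

/-! ### Ergodic properties and the Cesàro means -/

theorem HasGeometricDecay.powerBounded {T : 𝓢(ℝ, ℂ) →L[ℂ] 𝓢(ℝ, ℂ)} (hT : HasGeometricDecay T) :
    PowerBounded T := by
  refine (((schwartz_withSeminorms ℂ ℝ ℂ).equicontinuous_TFAE
    (fun n : ℕ => ((T ^ n : 𝓢(ℝ, ℂ) →L[ℂ] 𝓢(ℝ, ℂ)) : 𝓢(ℝ, ℂ) →ₗ[ℂ] 𝓢(ℝ, ℂ)))).out 3 1).1 fun i => ?_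
  obtain ⟨q, hq, h⟩ := hT i.1 i.2
  refine ⟨q, hq, fun n f => (h n f).trans ?_⟩
  exact mul_le_of_le_one_left (apply_nonneg q f) (pow_le_one₀ (by norm_num) (by norm_num))

/-- A sequence of operators whose Schwartz seminorms are at most a null sequence times a continuous
seminorm converges to `0` uniformly on bounded sets. -/
theorem tendsto_zero_of_seminorm_le {A : ℕ → 𝓢(ℝ, ℂ) →L[ℂ] 𝓢(ℝ, ℂ)} {ε : ℕ → ℝ}
    (hε : Tendsto ε atTop (𝓝 0))
    (h : ∀ k j : ℕ, ∃ q : Seminorm ℂ 𝓢(ℝ, ℂ), Continuous q ∧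
      ∀ (n : ℕ) (f : 𝓢(ℝ, ℂ)), SchwartzMap.seminorm ℂ k j (A n f) ≤ ε n * q f) :
    Tendsto A atTop (𝓝 0) := by
  rw [ContinuousLinearMap.nhds_zero_eq]
  simp only [tendsto_iInf, tendsto_principal]
  intro S hS U hU
  obtain ⟨⟨s, r⟩, hr, hsU⟩ := (schwartz_withSeminorms ℂ ℝ ℂ).hasBasis_ball.mem_iff.1 hU
  have key : ∀ i ∈ s, ∀ᶠ n in atTop, ∀ f ∈ S, schwartzSeminormFamily ℂ ℝ ℂ i (A n f) < r := by
    intro i _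
    obtain ⟨q, hq, hA⟩ := h i.1 i.2
    obtain ⟨I, C, -, hqI⟩ := Seminorm.bound_of_continuous (schwartz_withSeminorms ℂ ℝ ℂ) q hq
    obtain ⟨B, hB, hSB⟩ :=
      (schwartz_withSeminorms ℂ ℝ ℂ).isVonNBounded_iff_finset_seminorm_bounded.1 hS I
    have hlim : Tendsto (fun n => |ε n| * (C * B)) atTop (𝓝 0) := by
      simpa using hε.abs.mul_const (C * B : ℝ)
    filter_upwards [hlim.eventually_lt_const hr] with n hn f hf
    refine lt_of_le_of_lt ((hA n f).trans ?_) hn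
    have h1 : q f ≤ C * B := (hqI f).trans (by
      rw [smul_apply, NNReal.smul_def, smul_eq_mul]
      gcongr
      exact (hSB f hf).le)
    calc ε n * q f ≤ |ε n| * q f := by gcongr; exact le_abs_self _
      _ ≤ _ := by gcongr
  filter_upwards [(Finset.eventually_all s).2 key] with n hn f hf
  refine hsU ?_
  rw [Seminorm.mem_ball_zero]
  exact Seminorm.finset_sup_apply_lt hr fun i hi => hn i hi f hf

theorem HasGeometricDecay.iteratesTendToZero {T : 𝓢(ℝ, ℂ) →L[ℂ] 𝓢(ℝ, ℂ)}
    (hT : HasGeometricDecay T) : IteratesTendToZero T :=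
  tendsto_zero_of_seminorm_le
    (tendsto_pow_atTop_nhds_zero_of_lt_one (by norm_num) (by norm_num)) hT

theorem seminorm_cesaroMean_le (T : 𝓢(ℝ, ℂ) →L[ℂ] 𝓢(ℝ, ℂ)) (p : Seminorm ℂ 𝓢(ℝ, ℂ)) (n : ℕ)
    (f : 𝓢(ℝ, ℂ)) :
    p (cesaroMean T n f) ≤ (n : ℝ)⁻¹ * ∑ m ∈ Finset.Icc 1 n, p ((T ^ m) f) := by
  simp only [cesaroMean, smul_apply, sum_apply, map_smul_eq_mul, norm_inv,
    Complex.norm_natCast]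
  gcongr
  exact Finset.le_sum_of_subadditive p (map_zero p).le (map_add_le_add p) _ _

theorem HasGeometricDecay.tendsto_cesaroMean {T : 𝓢(ℝ, ℂ) →L[ℂ] 𝓢(ℝ, ℂ)}
    (hT : HasGeometricDecay T) : Tendsto (cesaroMean T) atTop (𝓝 0) := by
  refine tendsto_zero_of_seminorm_le (ε := fun n : ℕ => (n : ℝ)⁻¹ * 2) ?_ fun k j => ?_
  · simpa using (tendsto_inv_atTop_nhds_zero_nat (𝕜 := ℝ)).mul_const 2
  · obtain ⟨q, hq, h⟩ := hT k j
    refine ⟨q, hq, fun n f => (seminorm_cesaroMean_le T _ n f).trans ?_⟩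
    rw [mul_assoc]
    gcongr
    calc _ ≤ ∑ m ∈ Finset.Icc 1 n, ((1 : ℝ) / 2) ^ m * q f := Finset.sum_le_sum fun m _ => h m f
      _ = (∑ m ∈ Finset.Icc 1 n, ((1 : ℝ) / 2) ^ m) * q f := by rw [Finset.sum_mul]
      _ ≤ 2 * q f := by
        gcongr
        exact (summable_geometric_two.sum_le_tsum _ fun i _ => by positivity).trans_eq
          tsum_geometric_two

theorem HasGeometricDecay.uniformlyMeanErgodic {T : 𝓢(ℝ, ℂ) →L[ℂ] 𝓢(ℝ, ℂ)}
    (hT : HasGeometricDecay T) : UniformlyMeanErgodic T := ⟨0, hT.tendsto_cesaroMean⟩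

theorem HasGeometricDecay.cesaroBounded {T : 𝓢(ℝ, ℂ) →L[ℂ] 𝓢(ℝ, ℂ)}
    (hT : HasGeometricDecay T) : CesaroBounded T :=
  hT.tendsto_cesaroMean.isVonNBounded_range ℂ

theorem tendsto_apply_of_tendsto {A : ℕ → 𝓢(ℝ, ℂ) →L[ℂ] 𝓢(ℝ, ℂ)} {P : 𝓢(ℝ, ℂ) →L[ℂ] 𝓢(ℝ, ℂ)}
    (h : Tendsto A atTop (𝓝 P)) (f : 𝓢(ℝ, ℂ)) : Tendsto (fun n => A n f) atTop (𝓝 (P f)) :=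
  ((continuous_eval_const f).tendsto P).comp h

theorem UniformlyMeanErgodic.meanErgodic {T : 𝓢(ℝ, ℂ) →L[ℂ] 𝓢(ℝ, ℂ)}
    (hT : UniformlyMeanErgodic T) : MeanErgodic T := by
  obtain ⟨P, hP⟩ := hT
  exact fun f => ⟨P f, tendsto_apply_of_tendsto hP f⟩

/-- The Cesàro means of `T` are pointwise bounded, seminorm by seminorm. -/
def CesaroPointwiseBounded (T : 𝓢(ℝ, ℂ) →L[ℂ] 𝓢(ℝ, ℂ)) : Prop :=
  ∀ (f : 𝓢(ℝ, ℂ)) (k j : ℕ), ∃ B : ℝ, ∀ n : ℕ, SchwartzMap.seminorm ℂ k j (cesaroMean T n f) ≤ B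

theorem exists_seminorm_le_of_tendsto {u : ℕ → 𝓢(ℝ, ℂ)} {g : 𝓢(ℝ, ℂ)} (h : Tendsto u atTop (𝓝 g))
    (k j : ℕ) : ∃ B : ℝ, ∀ n, SchwartzMap.seminorm ℂ k j (u n) ≤ B := by
  have := (((schwartz_withSeminorms ℂ ℝ ℂ).continuous_seminorm (k, j)).tendsto g).comp h
  obtain ⟨B, hB⟩ := this.bddAbove_range
  exact ⟨B, fun n => hB ⟨n, rfl⟩⟩

theorem MeanErgodic.cesaroPointwiseBounded {T : 𝓢(ℝ, ℂ) →L[ℂ] 𝓢(ℝ, ℂ)} (hT : MeanErgodic T) :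
    CesaroPointwiseBounded T := fun f k j => by
  obtain ⟨g, hg⟩ := hT f
  exact exists_seminorm_le_of_tendsto hg k j

theorem CesaroBounded.cesaroPointwiseBounded {T : 𝓢(ℝ, ℂ) →L[ℂ] 𝓢(ℝ, ℂ)} (hT : CesaroBounded T) :
    CesaroPointwiseBounded T := fun f k j => by
  let ev : (𝓢(ℝ, ℂ) →L[ℂ] 𝓢(ℝ, ℂ)) →L[ℂ] 𝓢(ℝ, ℂ) :=
    { toFun := fun A => A f
      map_add' := fun _ _ => rfl
      map_smul' := fun _ _ => rfl
      cont := continuous_eval_const f }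
  have h := hT.image ev
  obtain ⟨r, -, hr⟩ := (schwartz_withSeminorms ℂ ℝ ℂ).isVonNBounded_iff_seminorm_bounded.1 h (k, j)
  exact ⟨r, fun n => (hr _ ⟨_, ⟨n, rfl⟩, rfl⟩).le⟩

theorem cesaroPointwiseBounded_of_iterates {T : 𝓢(ℝ, ℂ) →L[ℂ] 𝓢(ℝ, ℂ)}
    (h : ∀ (f : 𝓢(ℝ, ℂ)) (k j : ℕ), ∃ B : ℝ, ∀ n : ℕ, SchwartzMap.seminorm ℂ k j ((T ^ n) f) ≤ B) :
    CesaroPointwiseBounded T := fun f k j => by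
  obtain ⟨B, hB⟩ := h f k j
  have hB0 : 0 ≤ B := (apply_nonneg _ _).trans (hB 0)
  refine ⟨B, fun n => (seminorm_cesaroMean_le T _ n f).trans ?_⟩
  calc _ ≤ (n : ℝ)⁻¹ * ∑ m ∈ Finset.Icc 1 n, B := by
        gcongr with m
        exact hB m
    _ = (n : ℝ)⁻¹ * n * B := by simp [mul_assoc]
    _ ≤ B := mul_le_of_le_one_left hB0 inv_mul_le_one

theorem PowerBounded.cesaroPointwiseBounded {T : 𝓢(ℝ, ℂ) →L[ℂ] 𝓢(ℝ, ℂ)} (hT : PowerBounded T) :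
    CesaroPointwiseBounded T := by
  refine cesaroPointwiseBounded_of_iterates fun f k j => ?_
  have h := (((schwartz_withSeminorms ℂ ℝ ℂ).equicontinuous_TFAE
    (fun n : ℕ => ((T ^ n : 𝓢(ℝ, ℂ) →L[ℂ] 𝓢(ℝ, ℂ)) : 𝓢(ℝ, ℂ) →ₗ[ℂ] 𝓢(ℝ, ℂ)))).out 1 3
    rfl rfl).1 hT
  obtain ⟨q, -, h⟩ := h (k, j)
  exact ⟨q f, fun n => h n f⟩

theorem IteratesTendToZero.cesaroPointwiseBounded {T : 𝓢(ℝ, ℂ) →L[ℂ] 𝓢(ℝ, ℂ)}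
    (hT : IteratesTendToZero T) : CesaroPointwiseBounded T :=
  cesaroPointwiseBounded_of_iterates fun f =>
    exists_seminorm_le_of_tendsto (tendsto_apply_of_tendsto hT f)

/-! ### Polynomial symbols -/

theorem Polynomial.hasTemperateGrowth_eval (P : Polynomial ℝ) :
    (fun x : ℝ => P.eval x).HasTemperateGrowth := by
  simp only [Polynomial.eval_eq_sum_range]
  fun_prop

theorem Polynomial.exists_mul_sq_le_of_two_le_natDegree {P : Polynomial ℝ} (hP : 2 ≤ P.natDegree) :
    ∃ c > 0, ∀ x : ℝ, c * (1 + |x|) ^ 2 ≤ 1 + |P.eval x| := by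
  have hright : ∀ Q : Polynomial ℝ, 2 ≤ Q.natDegree →
      ∃ C > 0, ∀ᶠ x : ℝ in atTop, 1 + x ^ 2 ≤ C * |Q.eval x| := by
    intro Q hQ
    have hdeg : (1 + Polynomial.X ^ 2 : Polynomial ℝ).degree ≤ Q.degree := by
      rw [Polynomial.degree_eq_natDegree (p := Q) (by rintro rfl; simp at hQ)]
      have : (1 + Polynomial.X ^ 2 : Polynomial ℝ).degree ≤ (2 : ℕ) := by
        compute_degree
        exact le_rfl
      exact this.trans (mod_cast hQ)
    obtain ⟨C, hC, h⟩ := (Polynomial.isBigO_atTop_of_degree_le _ _ hdeg).exists_pos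
    refine ⟨C, hC, h.bound.mono fun x hx => ?_⟩
    simp only [Polynomial.eval_add, Polynomial.eval_one, Polynomial.eval_pow, Polynomial.eval_X,
      Real.norm_eq_abs] at hx
    exact (le_abs_self _).trans hx
  obtain ⟨C₁, hC₁, h₁⟩ := hright P hP
  obtain ⟨C₂, hC₂, h₂⟩ := hright (P.comp (-Polynomial.X)) (by
    rw [Polynomial.natDegree_comp]; simpa using hP)
  obtain ⟨A₁, hA₁⟩ := eventually_atTop.1 h₁
  obtain ⟨A₂, hA₂⟩ := eventually_atTop.1 h₂
  set A := max (max A₁ A₂) 0 with hA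
  set D := C₁ + C₂ + (1 + A ^ 2) with hD
  have hA2 := sq_nonneg A
  have hbound : ∀ x : ℝ, 1 + x ^ 2 ≤ D * (1 + |P.eval x|) := by
    intro x
    have h0 := abs_nonneg (P.eval x)
    rcases le_total A x with hx | hx
    · have := hA₁ x (le_trans (by simp [hA]) hx)
      nlinarith
    rcases le_total x (-A) with hx' | hx'
    · have := hA₂ (-x) (le_trans (by simp [hA]) (le_neg_of_le_neg hx'))
      simp only [Polynomial.eval_comp, Polynomial.eval_neg, Polynomial.eval_X, neg_neg, even_two,
        Even.neg_pow] at this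
      nlinarith
    · have : x ^ 2 ≤ A ^ 2 := sq_le_sq' hx' hx
      nlinarith
  have hD0 : 0 < D := by positivity
  refine ⟨1 / (2 * D), by positivity, fun x => ?_⟩
  have h1 := hbound x
  have h2 : (1 + |x|) ^ 2 ≤ 2 * (1 + x ^ 2) := by
    nlinarith [sq_nonneg (1 - |x|), sq_abs x]
  rw [one_div, inv_mul_le_iff₀ (by positivity)]
  linarith

theorem Polynomial.tendsto_eval_atTop_of_leadingCoeff_pos {P : Polynomial ℝ}
    (hP : 0 < P.natDegree) (hl : 0 < P.leadingCoeff) :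
    Tendsto (fun x : ℝ => P.eval x) atTop atTop :=
  P.tendsto_atTop_of_leadingCoeff_nonneg (Polynomial.natDegree_pos_iff_degree_pos.1 hP) hl.le

theorem Polynomial.exists_isRoot_of_odd_natDegree {P : Polynomial ℝ} (hP : Odd P.natDegree) :
    ∃ x, P.eval x = 0 := by
  wlog hl : 0 < P.leadingCoeff generalizing P
  · obtain ⟨x, hx⟩ := this (P := -P) (by simpa using hP) (by
      have h0 : P.leadingCoeff ≠ 0 := by
        rw [Ne, Polynomial.leadingCoeff_eq_zero]; rintro rfl; simp at hP
      rw [Polynomial.leadingCoeff_neg]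
      exact neg_pos.2 (lt_of_le_of_ne (not_lt.1 hl) h0))
    exact ⟨x, by simpa using hx⟩
  have h1 := P.tendsto_eval_atTop_of_leadingCoeff_pos hP.pos hl
  have h2 : Tendsto (fun x : ℝ => (-(P.comp (-Polynomial.X))).eval x) atTop atTop := by
    apply Polynomial.tendsto_eval_atTop_of_leadingCoeff_pos
    · rw [Polynomial.natDegree_neg, Polynomial.natDegree_comp]; simpa using hP.pos
    · rw [Polynomial.leadingCoeff_neg, Polynomial.leadingCoeff_comp (by simp)]
      simpa [hP.neg_one_pow] using hl
  obtain ⟨a, ha⟩ := (h1.eventually_ge_atTop 0).exists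
  obtain ⟨b, hb⟩ := (h2.eventually_ge_atTop 0).exists
  simp only [Polynomial.eval_neg, Polynomial.eval_comp, Polynomial.eval_X] at hb
  exact mem_range_of_exists_le_of_exists_ge P.continuous ⟨-b, by linarith⟩ ⟨a, ha⟩

theorem Polynomial.even_natDegree_of_forall_eval_ne {P : Polynomial ℝ} (hP : 2 ≤ P.natDegree)
    (h : ∀ x : ℝ, P.eval x ≠ x) : Even P.natDegree := by
  by_contra hodd
  rw [Nat.not_even_iff_odd] at hodd
  have hdeg : (P - Polynomial.X).natDegree = P.natDegree :=
    Polynomial.natDegree_sub_eq_left_of_natDegree_lt (by rw [Polynomial.natDegree_X]; omega)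
  obtain ⟨x, hx⟩ := Polynomial.exists_isRoot_of_odd_natDegree (hdeg.symm ▸ hodd)
  rw [Polynomial.eval_sub, Polynomial.eval_X] at hx
  exact h x (sub_eq_zero.1 hx)

theorem exists_weightedComposition {φ : ℝ → ℝ} (hφ : φ.HasTemperateGrowth) {c : ℝ} (hc : 0 < c)
    (hcφ : ∀ x, c * (1 + |x|) ^ 2 ≤ 1 + |φ x|) {ψ : ℝ → ℂ} (hψ : ψ.HasTemperateGrowth) :
    ∃ T : 𝓢(ℝ, ℂ) →L[ℂ] 𝓢(ℝ, ℂ), ∀ (f : 𝓢(ℝ, ℂ)) (x : ℝ), T f x = ψ x * f (φ x) := by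
  have hup : ∃ (k : ℕ) (C : ℝ), ∀ x, ‖x‖ ≤ C * (1 + ‖φ x‖) ^ k := by
    refine ⟨1, c⁻¹, fun x => ?_⟩
    rw [pow_one, Real.norm_eq_abs, Real.norm_eq_abs, le_inv_mul_iff₀ hc]
    refine le_trans ?_ (hcφ x)
    gcongr
    nlinarith [abs_nonneg x]
  refine ⟨(SchwartzMap.smulLeftCLM ℂ ψ).comp (SchwartzMap.compCLM ℂ hφ hup), fun f x => ?_⟩
  rw [ContinuousLinearMap.comp_apply, SchwartzMap.smulLeftCLM_apply_apply hψ]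
  simp

/-! ### Multipliers that act on the Schwartz space -/

theorem exists_schwartz_bump (y : ℝ) {r : ℝ} (hr : 0 < r) :
    ∃ (α : ℝ → ℝ) (χ : 𝓢(ℝ, ℂ)), (∀ x, χ x = α x) ∧ (∀ x, 0 ≤ α x) ∧
      (∀ x, |x - y| ≤ r / 2 → α x = 1) ∧ ∀ x, r ≤ |x - y| → α x = 0 := by
  let b : ContDiffBump y := ⟨r / 2, r, by positivity, by linarith⟩
  have hsupp : HasCompactSupport (fun x => (b x : ℂ)) :=
    b.hasCompactSupport.comp_left (g := fun t : ℝ => (t : ℂ)) (by simp)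
  have hsmooth : ContDiff ℝ ∞ (fun x => (b x : ℂ)) :=
    Complex.ofRealCLM.contDiff.comp b.contDiff
  refine ⟨b, hsupp.toSchwartzMap hsmooth, fun x => rfl, fun x => b.nonneg, fun x hx => ?_,
    fun x hx => ?_⟩
  · exact b.one_of_mem_closedBall (by simpa [Real.dist_eq] using hx)
  · exact b.zero_of_le_dist (by simpa [Real.dist_eq] using hx)

/-- A series of Schwartz functions all of whose seminorms are summable has a Schwartz sum. -/
theorem SchwartzMap.exists_apply_eq_tsum {u : ℕ → 𝓢(ℝ, ℂ)}
    (hu : ∀ k j : ℕ, Summable fun n => SchwartzMap.seminorm ℂ k j (u n)) :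
    ∃ f : 𝓢(ℝ, ℂ), ∀ x, f x = ∑' n, u n x := by
  have hs : ∀ n, ContDiff ℝ ((⊤ : ℕ∞) : WithTop ℕ∞) (u n) := fun n => (u n).smooth ⊤
  have hb : ∀ (j n : ℕ) (x : ℝ), (j : ℕ∞) ≤ (⊤ : ℕ∞) →
      ‖iteratedFDeriv ℝ j (u n) x‖ ≤ SchwartzMap.seminorm ℂ 0 j (u n) :=
    fun j n x _ => SchwartzMap.norm_iteratedFDeriv_le_seminorm ℂ (u n) j x
  refine ⟨⟨fun x => ∑' n, u n x, contDiff_tsum hs (fun j _ => hu 0 j) hb, fun k j => ?_⟩,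
    fun x => rfl⟩
  refine ⟨∑' n, SchwartzMap.seminorm ℂ k j (u n), fun x => ?_⟩
  rw [iteratedFDeriv_tsum_apply hs (fun j _ => hu 0 j) hb le_top x]
  have hsum : Summable fun n => ‖iteratedFDeriv ℝ j (u n) x‖ :=
    (hu 0 j).of_nonneg_of_le (fun _ => norm_nonneg _) fun n => hb j n x le_top
  calc _ ≤ ‖x‖ ^ k * ∑' n, ‖iteratedFDeriv ℝ j (u n) x‖ := by
        gcongr
        exact norm_tsum_le_tsum_norm hsum
    _ = ∑' n, ‖x‖ ^ k * ‖iteratedFDeriv ℝ j (u n) x‖ := tsum_mul_left.symm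
    _ ≤ _ := (hsum.mul_left _).tsum_le_tsum
        (fun n => SchwartzMap.le_seminorm ℂ k j (u n) x) (hu k j)

theorem SchwartzMap.exists_seminorm_compSubConst_le (χ : 𝓢(ℝ, ℂ)) (k j : ℕ) : ∃ C : ℝ, 0 ≤ C ∧
    ∀ t : ℝ, SchwartzMap.seminorm ℂ k j (SchwartzMap.compSubConstCLM ℂ t χ)
      ≤ C * (1 + |t|) ^ k := by
  refine ⟨2 ^ k * (Finset.Iic (k, j)).sup (schwartzSeminormFamily ℂ ℝ ℂ) χ, by positivity,
    fun t => ?_⟩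
  refine SchwartzMap.seminorm_le_bound ℂ k j _ (by positivity) fun x => ?_
  have h := SchwartzMap.one_add_le_sup_seminorm_apply (𝕜 := ℂ) (m := (k, j)) le_rfl le_rfl χ (x - t)
  have h2 : iteratedFDeriv ℝ j (SchwartzMap.compSubConstCLM ℂ t χ) x
      = iteratedFDeriv ℝ j χ (x - t) := by
    rw [← iteratedFDeriv_comp_sub]
    rfl
  rw [h2]
  have h3 : ‖x‖ ≤ (1 + ‖x - t‖) * (1 + |t|) := by
    have : ‖x‖ ≤ ‖x - t‖ + |t| := by simpa using norm_add_le (x - t) t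
    nlinarith [norm_nonneg (x - t), abs_nonneg t, mul_nonneg (norm_nonneg (x - t)) (abs_nonneg t)]
  calc _ ≤ ((1 + ‖x - t‖) * (1 + |t|)) ^ k * ‖iteratedFDeriv ℝ j χ (x - t)‖ := by gcongr
    _ = (1 + ‖x - t‖) ^ k * ‖iteratedFDeriv ℝ j χ (x - t)‖ * (1 + |t|) ^ k := by
      rw [mul_pow]; ring
    _ ≤ _ := mul_le_mul_of_nonneg_right h (by positivity)

/-- A Schwartz function that equals `(1 + |t n|) ^ (-n)` near each point of a sparse sequence `t`:
a superposition of translated bumps. -/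
theorem exists_schwartz_eventuallyEq_const {t : ℕ → ℝ} (ht : ∀ n, |t n| + 3 ≤ |t (n + 1)|) :
    ∃ f : 𝓢(ℝ, ℂ), ∀ n, ∀ᶠ y in 𝓝 (t n), f y = ((((1 + |t n|) ^ n)⁻¹ : ℝ) : ℂ) := by
  have hmono : ∀ m n, m < n → |t m| + 3 ≤ |t n| := by
    intro m n hmn
    induction n, hmn using Nat.le_induction with
    | base => exact ht m
    | succ n _ ih => linarith [ht n]
  have hsep : ∀ m n, m ≠ n → 3 ≤ |t m - t n| := by
    intro m n hmn
    rcases lt_or_gt_of_ne hmn with h | h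
    · have := abs_sub_abs_le_abs_sub (t n) (t m)
      rw [abs_sub_comm] at this
      linarith [hmono m n h]
    · have := abs_sub_abs_le_abs_sub (t m) (t n)
      linarith [hmono n m h]
  have hge : ∀ n : ℕ, (n : ℝ) ≤ |t n| := by
    intro n
    induction n with
    | zero => simp
    | succ n ih => push_cast; linarith [ht n]
  obtain ⟨α, χ, hχ, -, hone, hzero⟩ := exists_schwartz_bump 0 (r := 2) (by norm_num)
  let c : ℕ → ℝ := fun n => ((1 + |t n|) ^ n)⁻¹
  let u : ℕ → 𝓢(ℝ, ℂ) := fun n => (c n : ℂ) • SchwartzMap.compSubConstCLM ℂ (t n) χ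
  have hu : ∀ n x, u n x = c n * α (x - t n) := fun n x => by
    simp [u, hχ]
  have hsum : ∀ k j : ℕ, Summable fun n => SchwartzMap.seminorm ℂ k j (u n) := by
    intro k j
    obtain ⟨C, hC, h⟩ := χ.exists_seminorm_compSubConst_le k j
    refine Summable.of_norm_bounded_eventually_nat (g := fun n : ℕ => C * ((n : ℝ) ^ 2)⁻¹)
      ((Real.summable_nat_pow_inv.2 (by norm_num)).mul_left C) ?_
    filter_upwards [eventually_ge_atTop (k + 2)] with n hn
    have h1 : 1 ≤ 1 + |t n| := by linarith [abs_nonneg (t n)]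
    have h0 : (0 : ℝ) < n := by exact_mod_cast (by omega : 0 < n)
    have hc0 : 0 ≤ c n := by positivity
    rw [Real.norm_of_nonneg (apply_nonneg _ _), map_smul_eq_mul, Complex.norm_real,
      Real.norm_of_nonneg hc0]
    calc c n * _ ≤ c n * (C * (1 + |t n|) ^ k) := by gcongr; exact h _
      _ = C * ((1 + |t n|) ^ k / (1 + |t n|) ^ n) := by simp only [c]; ring
      _ ≤ C * ((n : ℝ) ^ 2)⁻¹ := by
        gcongr
        rw [div_le_iff₀ (by positivity), le_inv_mul_iff₀ (by positivity)]
        calc (n : ℝ) ^ 2 * (1 + |t n|) ^ k ≤ (1 + |t n|) ^ 2 * (1 + |t n|) ^ k := by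
              gcongr
              linarith [hge n]
          _ = (1 + |t n|) ^ (k + 2) := by ring
          _ ≤ _ := pow_le_pow_right₀ h1 hn
  obtain ⟨f, hf⟩ := SchwartzMap.exists_apply_eq_tsum hsum
  refine ⟨f, fun n => ?_⟩
  filter_upwards [Metric.ball_mem_nhds (t n) one_pos] with y hy
  rw [Metric.mem_ball, Real.dist_eq] at hy
  rw [hf, tsum_eq_single n]
  · rw [hu, hone (y - t n) (by rw [sub_zero]; linarith)]
    simp [c]
  · intro m hm
    rw [hu, hzero (y - t m), Complex.ofReal_zero, mul_zero]
    have h1 := hsep n m hm.symm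
    have h2 := abs_sub_abs_le_abs_sub (t n - t m) (t n - y)
    rw [abs_sub_comm (t n) y, show t n - t m - (t n - y) = y - t m by ring] at h2
    rw [sub_zero]
    linarith

/-- A smooth multiplier `ψ` for which `C_{ψ,φ}` acts on the Schwartz space has polynomially bounded
derivatives. Otherwise some derivative of `ψ` is huge along a sequence `x n` for which `φ (x n)` is
sparse, and it remains huge after multiplication by `f ∘ φ`, for a Schwartz function `f` that is a
small constant near each `φ (x n)`. -/
theorem ActsOnSchwartz.hasTemperateGrowth {φ : ℝ → ℝ} (hφ : φ.HasTemperateGrowth) {c : ℝ}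
    (hc : 0 < c) (hcφ : ∀ x, c * (1 + |x|) ^ 2 ≤ 1 + |φ x|) {ψ : ℝ → ℂ} (hψ : ContDiff ℝ ∞ ψ)
    (hacts : ActsOnSchwartz ψ φ) : ψ.HasTemperateGrowth := by
  refine hasTemperateGrowth_of_iteratedDeriv hψ fun j => ?_
  suffices h : ∃ (k : ℕ) (C : ℝ), 0 ≤ C ∧ ∀ x, ‖iteratedDeriv j ψ x‖ ≤ C * (1 + |φ x|) ^ k by
    obtain ⟨k, C, hC, h⟩ := h
    obtain ⟨p, A, hA, hφp⟩ := hφ.norm_iteratedDeriv_le 0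
    refine ⟨p * k, C * (1 + A) ^ k, fun x => (h x).trans ?_⟩
    have h1 := hφp x
    rw [iteratedDeriv_zero, Real.norm_eq_abs] at h1
    have h2 : 1 ≤ (1 + |x|) ^ p := one_le_pow₀ (by linarith [abs_nonneg x])
    calc C * (1 + |φ x|) ^ k ≤ C * ((1 + A) * (1 + |x|) ^ p) ^ k := by
          gcongr
          linarith
      _ = _ := by rw [mul_pow, pow_mul, mul_assoc]
  by_contra! hunb
  have hlarge : ∀ (k : ℕ) (R : ℝ), ∃ x, R ≤ |φ x| ∧ (1 + |φ x|) ^ k < ‖iteratedDeriv j ψ x‖ := by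
    intro k R
    by_contra! h
    obtain ⟨B, hB⟩ :=
      (isCompact_Icc (a := -((1 + R) / c)) (b := (1 + R) / c)).exists_bound_of_continuousOn
        ((hψ.continuous_iteratedDeriv j (mod_cast le_top)).continuousOn)
    obtain ⟨x, hx⟩ := hunb k (max 1 B) (by positivity)
    have h1 : 1 ≤ (1 + |φ x|) ^ k := one_le_pow₀ (by linarith [abs_nonneg (φ x)])
    rcases le_total R |φ x| with hR | hR
    · have := h x hR
      have h2 : 1 * (1 + |φ x|) ^ k ≤ max 1 B * (1 + |φ x|) ^ k := by gcongr; exact le_max_left _ _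
      linarith
    · have h3 : |x| ≤ (1 + R) / c := by
        rw [le_div_iff₀ hc]
        nlinarith [hcφ x, mul_nonneg hc.le (abs_nonneg x), mul_nonneg hc.le (sq_nonneg |x|)]
      have h4 := hB x (abs_le.1 h3)
      have h5 : B ≤ max 1 B * (1 + |φ x|) ^ k :=
        (le_max_right 1 B).trans (le_mul_of_one_le_right (by positivity) h1)
      linarith
  -- the exponent `2 n` beats the factor `(1 + |φ (x n)|) ^ (-n)` that `f ∘ φ` contributes at `x n`
  choose X hX hXψ using hlarge
  let x : ℕ → ℝ := fun n => Nat.rec (X 0 0) (fun n y => X (2 * (n + 1)) (|φ y| + 3)) n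
  have hxψ : ∀ n, (1 + |φ (x n)|) ^ (2 * n) < ‖iteratedDeriv j ψ (x n)‖ := by
    intro n
    cases n with
    | zero => exact hXψ 0 0
    | succ n => exact hXψ (2 * (n + 1)) _
  have hstep : ∀ n, |φ (x n)| + 3 ≤ |φ (x (n + 1))| := fun n => hX (2 * (n + 1)) _
  have hge : ∀ n : ℕ, (n : ℝ) ≤ |φ (x n)| := by
    intro n
    induction n with
    | zero => simp
    | succ n ih => push_cast; linarith [hstep n]
  obtain ⟨f, hf⟩ := exists_schwartz_eventuallyEq_const (t := fun n => φ (x n)) hstep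
  obtain ⟨g, hg⟩ := hacts f
  obtain ⟨n, hn⟩ := exists_nat_gt (SchwartzMap.seminorm ℂ 0 j g)
  set s := 1 + |φ (x (n + 1))| with hs
  have hs1 : (n : ℝ) + 1 ≤ s := by
    have := hge (n + 1)
    push_cast at this
    linarith
  have hs0 : 0 < s := by positivity
  have hloc : (g : ℝ → ℂ) =ᶠ[𝓝 (x (n + 1))] fun y => (((s ^ (n + 1))⁻¹ : ℝ) : ℂ) * ψ y := by
    filter_upwards [hφ.1.continuous.continuousAt.eventually (hf (n + 1))] with y hy
    rw [hg, hy, mul_comm]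
  have h1 := SchwartzMap.le_seminorm' ℂ 0 j g (x (n + 1))
  rw [pow_zero, one_mul, hloc.iteratedDeriv_eq j, iteratedDeriv_const_mul_field, norm_mul,
    Complex.norm_real, Real.norm_of_nonneg (by positivity)] at h1
  have h2 : s ^ (n + 1) ≤ (s ^ (n + 1))⁻¹ * ‖iteratedDeriv j ψ (x (n + 1))‖ := by
    rw [le_inv_mul_iff₀ (by positivity), ← pow_add, ← two_mul]
    exact (hxψ (n + 1)).le
  have h3 : s ≤ s ^ (n + 1) := le_self_pow₀ (by linarith [n.cast_nonneg (α := ℝ)]) (by omega)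
  linarith

/-! ### Backward orbits of polynomials with fixed points -/

/-- There are points `z` whose `n`-th iterate under `g` is `y` and whose distance to `a` is at most
of order `n ^ (-1 / p)`, for a fixed `p`. -/
def HasBackwardOrbit (g : ℝ → ℝ) (a y : ℝ) : Prop :=
  ∃ (p : ℕ) (D : ℝ), ∀ n : ℕ, ∃ z : ℝ, g^[n] z = y ∧ n * |z - a| ^ p ≤ D

/-- If `Q` moves all points on the right of its fixed point `a` to the right, then backward orbits
approach `a`. The order of contact of `Q` with the identity at `a` is finite, which bounds the
steps of the orbit from below by a power of the distance to `a`; they sum to at most `y - a`. -/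
theorem Polynomial.hasBackwardOrbit {Q : Polynomial ℝ} {a : ℝ} (hQa : Q.eval a = a)
    (hQ : ∀ x, a < x → x < Q.eval x) {y : ℝ} (hy : a < y) :
    HasBackwardOrbit (fun x => Q.eval x) a y := by
  have hne : Q - Polynomial.X ≠ 0 := by
    intro h
    have := congrArg (Polynomial.eval y) h
    simp only [Polynomial.eval_sub, Polynomial.eval_X, Polynomial.eval_zero] at this
    linarith [hQ y hy]
  obtain ⟨q, hq, hdvd⟩ := (Q - Polynomial.X).exists_eq_pow_rootMultiplicity_mul_and_not_dvd hne a
  set p := (Q - Polynomial.X).rootMultiplicity a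
  have hqa : q.eval a ≠ 0 := fun h => hdvd (Polynomial.dvd_iff_isRoot.2 h)
  have hval : ∀ x, Q.eval x - x = (x - a) ^ p * q.eval x := by
    intro x
    have := congrArg (Polynomial.eval x) hq
    simpa using this
  obtain ⟨w, hw, hmin⟩ := (isCompact_Icc (a := a) (b := y)).exists_isMinOn ⟨a, le_rfl, hy.le⟩
    (f := fun x => |q.eval x|) (by fun_prop)
  set c := |q.eval w| with hc
  have hc0 : 0 < c := by
    rw [hc, abs_pos]
    rcases hw.1.eq_or_lt with h | h
    · rwa [← h]
    · intro h0
      have := hval w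
      rw [h0, mul_zero] at this
      linarith [hQ w h]
  have hstep : ∀ x, a < x → x ≤ y → c * (x - a) ^ p ≤ Q.eval x - x := by
    intro x hax hxy
    have h1 : c ≤ |q.eval x| := hmin ⟨hax.le, hxy⟩
    have h2 : 0 < Q.eval x - x := by linarith [hQ x hax]
    have h3 : 0 ≤ (x - a) ^ p := pow_nonneg (by linarith) p
    calc c * (x - a) ^ p ≤ |q.eval x| * (x - a) ^ p := by gcongr
      _ = |(x - a) ^ p * q.eval x| := by rw [abs_mul, abs_of_nonneg h3, mul_comm]
      _ = _ := by rw [← hval, abs_of_pos h2]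
  have horbit : ∀ n : ℕ, ∃ z, a < z ∧ z ≤ y ∧ (fun x => Q.eval x)^[n] z = y ∧
      n * (c * (z - a) ^ p) ≤ y - z := by
    intro n
    induction n with
    | zero => exact ⟨y, hy, le_rfl, rfl, by simp⟩
    | succ n ih =>
      obtain ⟨z, haz, hzy, hiter, hsum⟩ := ih
      obtain ⟨z', ⟨haz', hz'z⟩, hz'⟩ := intermediate_value_Icc haz.le
        (f := fun x => Q.eval x) Q.continuous.continuousOn
        (show z ∈ Set.Icc (Q.eval a) (Q.eval z) from ⟨by rw [hQa]; exact haz.le, (hQ z haz).le⟩)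
      have hz'' : Q.eval z' = z := hz'
      have hlt : a < z' := by
        refine lt_of_le_of_ne haz' ?_
        rintro rfl
        rw [hQa] at hz''
        exact haz.ne hz''
      refine ⟨z', hlt, hz'z.trans hzy, by rw [Function.iterate_succ_apply, hz'', hiter], ?_⟩
      have h1 := hstep z' hlt (hz'z.trans hzy)
      rw [hz''] at h1
      have h2 : (n : ℝ) * (c * (z' - a) ^ p) ≤ n * (c * (z - a) ^ p) := by
        have : 0 ≤ z' - a := by linarith
        gcongr
      push_cast
      linarith
  refine ⟨p, (y - a) / c, fun n => ?_⟩
  obtain ⟨z, haz, -, hiter, hsum⟩ := horbit n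
  refine ⟨z, hiter, ?_⟩
  rw [le_div_iff₀ hc0, abs_of_pos (by linarith)]
  linarith

theorem HasBackwardOrbit.of_neg {g : ℝ → ℝ} {a y : ℝ}
    (h : HasBackwardOrbit (fun x => -g (-x)) a y) : HasBackwardOrbit g (-a) (-y) := by
  obtain ⟨p, D, h⟩ := h
  refine ⟨p, D, fun n => ?_⟩
  obtain ⟨z, hz, hD⟩ := h n
  refine ⟨-z, ?_, ?_⟩
  · have hsemi : Function.Semiconj (fun x : ℝ => -x) (fun x => -g (-x)) g := fun x => by simp
    rw [← hz]
    exact ((hsemi.iterate_right n) z).symm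
  · rwa [← neg_add', abs_neg, ← sub_eq_add_neg] at *

theorem Polynomial.exists_hasBackwardOrbit_of_leadingCoeff_pos {Q : Polynomial ℝ}
    (hQ : 2 ≤ Q.natDegree) (hl : 0 < Q.leadingCoeff) (hfix : ∃ x, Q.eval x = x) :
    ∃ a, Q.eval a = a ∧ ∀ y, a < y → HasBackwardOrbit (fun x => Q.eval x) a y := by
  set P := Q - Polynomial.X with hP
  have hlt : (Polynomial.X : Polynomial ℝ).natDegree < Q.natDegree := by
    rw [Polynomial.natDegree_X]; omega
  have hdeg : P.natDegree = Q.natDegree := Polynomial.natDegree_sub_eq_left_of_natDegree_lt hlt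
  have hPl : 0 < P.leadingCoeff := by
    rwa [hP, Polynomial.leadingCoeff_sub_of_degree_lt (Polynomial.degree_lt_degree hlt)]
  have hP0 : P ≠ 0 := by rintro h; rw [h] at hPl; simp at hPl
  have hroot : ∀ x, P.eval x = Q.eval x - x := fun x => by simp [hP]
  obtain ⟨x₀, hx₀⟩ := hfix
  -- the largest fixed point
  obtain ⟨a, ha, hmax⟩ := P.roots.toFinset.exists_max_image id ⟨x₀, by
    rw [Multiset.mem_toFinset, Polynomial.mem_roots hP0, Polynomial.IsRoot, hroot, hx₀, sub_self]⟩
  have hmem : ∀ x, x ∈ P.roots.toFinset ↔ Q.eval x - x = 0 := fun x => by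
    rw [Multiset.mem_toFinset, Polynomial.mem_roots hP0, Polynomial.IsRoot, hroot]
  have hQa : Q.eval a = a := sub_eq_zero.1 ((hmem a).1 ha)
  refine ⟨a, hQa, fun y hy => Polynomial.hasBackwardOrbit hQa (fun x hx => ?_) hy⟩
  by_contra! hle
  obtain ⟨b, hb0, hxb⟩ := (((P.tendsto_eval_atTop_of_leadingCoeff_pos (by omega) hPl)
    |>.eventually_ge_atTop 0).and (eventually_ge_atTop x)).exists
  obtain ⟨r, ⟨hxr, -⟩, hr⟩ := intermediate_value_Icc hxb (f := fun x => P.eval x)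
    P.continuous.continuousOn (show (0 : ℝ) ∈ Set.Icc (P.eval x) (P.eval b) from
      ⟨by rw [hroot]; linarith, hb0⟩)
  have := hmax r ((hmem r).2 (by rw [← hroot]; exact hr))
  simp only [id] at this
  linarith

/-- A polynomial with a fixed point has a point `a` of period at most two that backward orbits of its
second iterate approach from one side. The second iterate is needed for odd degree and negative
leading coefficient, where the orbits of `φ` itself oscillate. -/
theorem Polynomial.exists_hasBackwardOrbit_comp_self {φ : Polynomial ℝ} (hφ : 2 ≤ φ.natDegree)
    (hfix : ∃ x, φ.eval x = x) :
    ∃ a y, φ.eval (φ.eval a) = a ∧ y ≠ a ∧ y ≠ φ.eval a ∧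
      HasBackwardOrbit (fun x => φ.eval (φ.eval x)) a y := by
  set Q := φ.comp φ with hQ
  have hQe : ∀ x, Q.eval x = φ.eval (φ.eval x) := fun x => Polynomial.eval_comp
  have hdeg : Q.natDegree = φ.natDegree * φ.natDegree := Polynomial.natDegree_comp
  have hQ2 : 2 ≤ Q.natDegree := by rw [hdeg]; nlinarith
  have hlead : Q.leadingCoeff = φ.leadingCoeff ^ (φ.natDegree + 1) := by
    rw [hQ, Polynomial.leadingCoeff_comp (by omega), pow_succ']
  have hl0 : φ.leadingCoeff ≠ 0 := by
    rw [Ne, Polynomial.leadingCoeff_eq_zero]; rintro rfl; simp at hφ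
  have hQfix : ∃ x, Q.eval x = x := by
    obtain ⟨x, hx⟩ := hfix
    exact ⟨x, by rw [hQe, hx, hx]⟩
  simp only [← hQe]
  -- `y` has to avoid both points of the cycle of `a`
  have hchoice : ∀ a b : ℝ, ∃ y, a < y ∧ y ≠ b := fun a b => by
    rcases eq_or_ne (a + 1) b with h | h
    · exact ⟨a + 2, by linarith, by rw [← h]; intro h'; linarith⟩
    · exact ⟨a + 1, by linarith, h⟩
  rcases lt_or_gt_of_ne (pow_ne_zero (φ.natDegree + 1) hl0) with hneg | hpos
  · -- here the degree is even, and conjugation by `x ↦ -x` makes the leading coefficient positive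
    have heven : Even φ.natDegree := by
      by_contra hodd
      rw [Nat.not_even_iff_odd] at hodd
      exact absurd (hodd.add_one.pow_nonneg φ.leadingCoeff) (not_le.2 hneg)
    set R := -(Q.comp (-Polynomial.X)) with hR
    have hRe : ∀ x, R.eval x = -Q.eval (-x) := fun x => by simp [hR]
    have hRdeg : R.natDegree = Q.natDegree := by
      rw [hR, Polynomial.natDegree_neg, Polynomial.natDegree_comp]; simp
    have hRl : 0 < R.leadingCoeff := by
      rw [hR, Polynomial.leadingCoeff_neg, Polynomial.leadingCoeff_comp (by simp),
        Polynomial.leadingCoeff_neg, Polynomial.leadingCoeff_X, hdeg,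
        (heven.mul_right _).neg_one_pow, hlead]
      linarith
    obtain ⟨a, ha, h⟩ := Polynomial.exists_hasBackwardOrbit_of_leadingCoeff_pos (by omega) hRl
      (by
        obtain ⟨x, hx⟩ := hQfix
        exact ⟨-x, by rw [hRe, neg_neg, hx]⟩)
    obtain ⟨y, hay, hy⟩ := hchoice a (-φ.eval (-a))
    have h1 := h y hay
    simp only [hRe] at h1 ha
    refine ⟨-a, -y, by linarith, fun h => hay.ne' (neg_injective h), fun h => hy ?_, h1.of_neg⟩
    rw [← h, neg_neg]
  · obtain ⟨a, ha, h⟩ := Polynomial.exists_hasBackwardOrbit_of_leadingCoeff_pos hQ2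
      (hlead ▸ hpos) hQfix
    obtain ⟨y, hay, hy⟩ := hchoice a (φ.eval a)
    exact ⟨a, y, ha, hay.ne', hy, h y hay⟩

/-! ### Fixed points obstruct boundedness of the Cesàro means -/

/-- A function that vanishes near `a` and whose `k`-th derivative is at most `B` is at most
`B * |z - a| ^ k`. -/
theorem norm_le_of_eventuallyEq_zero {a B : ℝ} (k : ℕ) : ∀ {g : ℝ → ℂ}, ContDiff ℝ ∞ g →
    g =ᶠ[𝓝 a] 0 → (∀ x, ‖iteratedDeriv k g x‖ ≤ B) → ∀ z, ‖g z‖ ≤ B * |z - a| ^ k := by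
  induction k with
  | zero => intro g _ _ h z; simpa using h z
  | succ k ih =>
    intro g hg hga h z
    have hg' := (contDiff_infty_iff_deriv.1 hg).2
    have hga' : deriv g =ᶠ[𝓝 a] 0 := by
      filter_upwards [hga.deriv] with x hx
      rw [hx]; exact deriv_const x 0
    have h1 := ih hg' hga' fun x => by rw [← iteratedDeriv_succ']; exact h x
    have hB : 0 ≤ B := (norm_nonneg _).trans (h 0)
    have h2 := (convex_uIcc a z).norm_image_sub_le_of_norm_deriv_le (f := g)
      (C := B * |z - a| ^ k) (fun x _ => (hg.differentiable (by simp)) x)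
      (fun x hx => (h1 x).trans (by
        have := Set.abs_sub_left_of_mem_uIcc hx
        exact mul_le_mul_of_nonneg_left (pow_le_pow_left₀ (abs_nonneg _) this k) hB))
      Set.left_mem_uIcc Set.right_mem_uIcc
    rw [hga.eq_of_nhds, Pi.zero_apply, sub_zero] at h2
    rwa [pow_succ, ← mul_assoc]

theorem pow_composition_apply {φ : ℝ → ℝ} {T : 𝓢(ℝ, ℂ) →L[ℂ] 𝓢(ℝ, ℂ)}
    (hT : ∀ (f : 𝓢(ℝ, ℂ)) (x : ℝ), T f x = f (φ x)) (n : ℕ) (f : 𝓢(ℝ, ℂ)) (x : ℝ) :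
    (T ^ n) f x = f (φ^[n] x) := by
  induction n generalizing x with
  | zero => rfl
  | succ n ih => rw [pow_succ', mul_apply_eq_comp, hT, ih, Function.iterate_succ_apply]

theorem cesaroMean_composition_apply {φ : ℝ → ℝ} {T : 𝓢(ℝ, ℂ) →L[ℂ] 𝓢(ℝ, ℂ)}
    (hT : ∀ (f : 𝓢(ℝ, ℂ)) (x : ℝ), T f x = f (φ x)) (n : ℕ) (f : 𝓢(ℝ, ℂ)) (x : ℝ) :
    cesaroMean T n f x = (n : ℂ)⁻¹ * ∑ m ∈ Finset.Icc 1 n, f (φ^[m] x) := by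
  simp only [cesaroMean, smul_apply, sum_apply, pow_composition_apply hT, smul_eq_mul]

/-- Suppose that backward orbits of `φ ∘ φ` approach a point `a` of period at most two. The Cesàro
means of a bump at `y` vanish near `a`, but at the `n`-th point of the backward orbit of `y` they
are at least `1 / (2 n)`. This point is so close to `a` that some derivative has to be large. -/
theorem not_cesaroPointwiseBounded_of_hasBackwardOrbit {φ : ℝ → ℝ} (hφ : Continuous φ)
    {T : 𝓢(ℝ, ℂ) →L[ℂ] 𝓢(ℝ, ℂ)} (hT : ∀ (f : 𝓢(ℝ, ℂ)) (x : ℝ), T f x = f (φ x)) {a y : ℝ}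
    (ha : φ (φ a) = a) (hya : y ≠ a) (hyb : y ≠ φ a)
    (horbit : HasBackwardOrbit (fun x => φ (φ x)) a y) : ¬ CesaroPointwiseBounded T := by
  intro hbdd
  obtain ⟨r, hr, hra, hrb⟩ : ∃ r > 0, r < |a - y| ∧ r < |φ a - y| := by
    obtain ⟨r, hr, h⟩ := exists_between
      (lt_min (abs_pos.2 (sub_ne_zero.2 hya.symm)) (abs_pos.2 (sub_ne_zero.2 hyb.symm)))
    exact ⟨r, hr, lt_min_iff.1 h⟩
  obtain ⟨α, f, hf, hα, hone, hzero⟩ := exists_schwartz_bump y hr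
  have hαy : α y = 1 := hone y (by simpa using (half_pos hr).le)
  have hnear : ∀ b, r < |b - y| → ∀ᶠ x in 𝓝 b, f x = 0 := by
    intro b hb
    have : ContinuousAt (fun x => |x - y|) b := by fun_prop
    filter_upwards [this.eventually_const_lt hb] with x hx
    rw [hf, hzero x hx.le, Complex.ofReal_zero]
  have hcycle : ∀ m : ℕ, φ^[m] a = a ∨ φ^[m] a = φ a := by
    intro m
    induction m with
    | zero => exact Or.inl rfl
    | succ m ih =>
      rw [Function.iterate_succ_apply']
      rcases ih with h | h
      · exact Or.inr (by rw [h])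
      · exact Or.inl (by rw [h, ha])
  have hflat : ∀ n : ℕ, (cesaroMean T n f : ℝ → ℂ) =ᶠ[𝓝 a] 0 := by
    intro n
    have h1 : ∀ m : ℕ, ∀ᶠ x in 𝓝 a, f (φ^[m] x) = 0 := by
      intro m
      have h2 : ∀ᶠ x in 𝓝 (φ^[m] a), f x = 0 := by
        rcases hcycle m with h | h
        · rw [h]; exact hnear a hra
        · rw [h]; exact hnear _ hrb
      exact ((hφ.iterate m).tendsto a).eventually h2
    filter_upwards [(Finset.eventually_all (Finset.Icc 1 n)).2 fun m _ => h1 m] with x hx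
    rw [cesaroMean_composition_apply hT, Finset.sum_eq_zero hx, mul_zero, Pi.zero_apply]
  obtain ⟨p, D, horbit⟩ := horbit
  -- `|z - a| ^ (2 p)` is of order `n ^ (-2)`, which is smaller than the value `1 / (2 n)` at `z`
  obtain ⟨B, hB⟩ := hbdd f 0 (2 * p)
  have hB0 : 0 ≤ B := (apply_nonneg _ _).trans (hB 0)
  have hmain : ∀ n : ℕ, 0 < n → (n : ℝ) ≤ 2 * B * D ^ 2 := by
    intro n hn
    obtain ⟨z, hz, hD⟩ := horbit n
    have hn0 : (0 : ℝ) < n := by exact_mod_cast hn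
    have hiter : φ^[2 * n] z = y := by
      rw [Function.iterate_mul]
      exact hz
    have hupper := norm_le_of_eventuallyEq_zero (2 * p) ((cesaroMean T (2 * n) f).smooth ⊤)
      (hflat (2 * n)) (fun x => (SchwartzMap.le_seminorm' ℂ 0 (2 * p) _ x |>.trans' (by simp)).trans
        (hB (2 * n))) z
    have hlower : 1 / (2 * n : ℝ) ≤ ‖cesaroMean T (2 * n) f z‖ := by
      have hsum : 1 ≤ ∑ m ∈ Finset.Icc 1 (2 * n), α (φ^[m] z) := by
        rw [← hαy, ← hiter]
        exact Finset.single_le_sum (f := fun m => α (φ^[m] z)) (fun m _ => hα _)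
          (Finset.mem_Icc.2 ⟨by omega, le_rfl⟩)
      have hreal : cesaroMean T (2 * n) f z =
          (((2 * n : ℝ)⁻¹ * ∑ m ∈ Finset.Icc 1 (2 * n), α (φ^[m] z) : ℝ) : ℂ) := by
        rw [cesaroMean_composition_apply hT]
        simp [hf]
      rw [hreal, Complex.norm_real, Real.norm_of_nonneg (by positivity), one_div]
      exact le_mul_of_one_le_right (by positivity) hsum
    have h1 : 1 / (2 * n : ℝ) ≤ B * |z - a| ^ (2 * p) := hlower.trans hupper
    have h2 : (n * |z - a| ^ p) ^ 2 ≤ D ^ 2 := pow_le_pow_left₀ (by positivity) hD 2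
    rw [div_le_iff₀ (by positivity)] at h1
    have h3 : (n : ℝ) * 1 ≤ n * (B * |z - a| ^ (2 * p) * (2 * n)) := by gcongr
    calc (n : ℝ) = n * 1 := (mul_one _).symm
      _ ≤ _ := h3
      _ = 2 * B * (n * |z - a| ^ p) ^ 2 := by rw [mul_pow, ← pow_mul, mul_comm p 2]; ring
      _ ≤ _ := by gcongr
  obtain ⟨n, hn⟩ := exists_nat_gt (2 * B * D ^ 2)
  have := hmain (n + 1) (by omega)
  push_cast at this
  linarith

/-! ### The equivalences -/

/-- For a property `P` between geometric decay of the iterates and pointwise boundedness of the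
Cesàro means, the three statements about `P` in the theorem all say that `φ` has no fixed points. -/
theorem forall_eval_ne_iff {φ : Polynomial ℝ} (hφ : 2 ≤ φ.natDegree)
    {P : (𝓢(ℝ, ℂ) →L[ℂ] 𝓢(ℝ, ℂ)) → Prop} (hdecay : ∀ T, HasGeometricDecay T → P T)
    (hbdd : ∀ T, P T → CesaroPointwiseBounded T) :
    ((∀ x : ℝ, φ.eval x ≠ x) ↔ CompositionHas P (fun x => φ.eval x)) ∧
    ((∀ x : ℝ, φ.eval x ≠ x) ↔ ForAllMultipliers P (fun x => φ.eval x)) ∧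
    ((∀ x : ℝ, φ.eval x ≠ x) ↔ ForAllSmallDecay P (fun x => φ.eval x)) := by
  have htemp := φ.hasTemperateGrowth_eval
  obtain ⟨c, hc, hcφ⟩ := Polynomial.exists_mul_sq_le_of_two_le_natDegree hφ
  have hone : (fun _ : ℝ => (1 : ℂ)).HasTemperateGrowth := .const 1
  have hmult : (∀ x : ℝ, φ.eval x ≠ x) → ForAllMultipliers P (fun x => φ.eval x) := by
    intro hfix ψ hψ
    obtain ⟨T, hT⟩ := exists_weightedComposition htemp hc hcφ hψ
    exact ⟨T, hT, hdecay T (hasGeometricDecay_of_forall_ne htemp hψ hc hcφ hfix hT)⟩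
  have hsmall : ForAllMultipliers P (fun x => φ.eval x) →
      ForAllSmallDecay P (fun x => φ.eval x) :=
    fun h ψ hψ _ hacts => h ψ (hacts.hasTemperateGrowth htemp hc hcφ hψ)
  have hcomp : ForAllSmallDecay P (fun x => φ.eval x) → CompositionHas P (fun x => φ.eval x) := by
    intro h
    refine h _ contDiff_const ⟨1, one_pos, 1, one_pos, fun x _ => ?_⟩ fun f => ?_
    · rw [Real.rpow_one, Real.rpow_one, norm_one, mul_one]
      exact one_le_mul_of_one_le_of_one_le (by linarith [abs_nonneg x])
        (by linarith [abs_nonneg (φ.eval x)])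
    · obtain ⟨T, hT⟩ := exists_weightedComposition htemp hc hcφ hone
      exact ⟨T f, hT f⟩
  have hfix : CompositionHas P (fun x => φ.eval x) → ∀ x : ℝ, φ.eval x ≠ x := by
    rintro ⟨T, hT, hPT⟩ x hx
    obtain ⟨a, y, ha, hya, hyb, horbit⟩ :=
      Polynomial.exists_hasBackwardOrbit_comp_self hφ ⟨x, hx⟩
    exact not_cesaroPointwiseBounded_of_hasBackwardOrbit (φ := fun x => φ.eval x) φ.continuous
      (fun f x => by rw [hT, one_mul]) ha hya hyb horbit (hbdd T hPT)
  exact ⟨⟨fun h => hcomp (hsmall (hmult h)), hfix⟩, ⟨hmult, fun h => hfix (hcomp (hsmall h))⟩,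
    ⟨fun h => hsmall (hmult h), fun h => hfix (hcomp h)⟩⟩

theorem mainTheorem1 (φ : Polynomial ℝ) (hφ : 2 ≤ φ.natDegree) :
    ((∀ x : ℝ, φ.eval x ≠ x) → Even φ.natDegree) ∧
    List.TFAE [
      ∀ x : ℝ, φ.eval x ≠ x,
      CompositionHas PowerBounded (fun x => φ.eval x),
      CompositionHas MeanErgodic (fun x => φ.eval x),
      CompositionHas UniformlyMeanErgodic (fun x => φ.eval x),
      CompositionHas IteratesTendToZero (fun x => φ.eval x),
      CompositionHas CesaroBounded (fun x => φ.eval x),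
      ForAllMultipliers PowerBounded (fun x => φ.eval x),
      ForAllSmallDecay PowerBounded (fun x => φ.eval x),
      ForAllMultipliers IteratesTendToZero (fun x => φ.eval x),
      ForAllSmallDecay IteratesTendToZero (fun x => φ.eval x),
      ForAllMultipliers MeanErgodic (fun x => φ.eval x),
      ForAllSmallDecay MeanErgodic (fun x => φ.eval x),
      ForAllMultipliers UniformlyMeanErgodic (fun x => φ.eval x),
      ForAllSmallDecay UniformlyMeanErgodic (fun x => φ.eval x)] := by
  refine ⟨Polynomial.even_natDegree_of_forall_eval_ne hφ, ?_⟩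
  obtain ⟨pb, pbO, pbS⟩ := forall_eval_ne_iff hφ (P := PowerBounded)
    (fun _ h => h.powerBounded) fun _ h => h.cesaroPointwiseBounded
  obtain ⟨me, meO, meS⟩ := forall_eval_ne_iff hφ (P := MeanErgodic)
    (fun _ h => h.uniformlyMeanErgodic.meanErgodic) fun _ h => h.cesaroPointwiseBounded
  obtain ⟨ue, ueO, ueS⟩ := forall_eval_ne_iff hφ (P := UniformlyMeanErgodic)
    (fun _ h => h.uniformlyMeanErgodic) fun _ h => h.meanErgodic.cesaroPointwiseBounded
  obtain ⟨tz, tzO, tzS⟩ := forall_eval_ne_iff hφ (P := IteratesTendToZero)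
    (fun _ h => h.iteratesTendToZero) fun _ h => h.cesaroPointwiseBounded
  obtain ⟨cb, -, -⟩ := forall_eval_ne_iff hφ (P := CesaroBounded)
    (fun _ h => h.cesaroBounded) fun _ h => h.cesaroPointwiseBounded
  rw [← pb, ← me, ← ue, ← tz, ← cb, ← pbO, ← pbS, ← tzO, ← tzS, ← meO, ← meS, ← ueO, ← ueS]
  tfae_finish
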